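/- The formulas of the logic $\mathcal{R}$Ł are built from propositional variables with the connectives $\neg$, $\to$ and $\nabla_r$ ($r\in[0,1]$). With $\varphi\vee\psi:=(\varphi\to\psi)\to\psi$, $\varphi\wedge\psi:=\neg(\neg\varphi\vee\neg\psi)$ and $\varphi\leftrightarrow\psi:=(\varphi\to\psi)\wedge(\psi\to\varphi)$, its axioms are those of Łukasiewicz logic, $$\varphi\to(\psi\to\varphi),\qquad (\varphi\to\psi)\to((\psi\to\chi)\to(\varphi\to\chi)),$$ $$((\varphi\to\psi)\to\psi)\to((\psi\to\varphi)\to\varphi),\qquad (\neg\psi\to\neg\varphi)\to(\varphi\to\psi),$$ together with, for all $r,q\in[0,1]$, $$\nabla_r(\varphi\to\psi)\leftrightarrow(\nabla_r\varphi\to\nabla_r\psi),\qquad \nabla_{\max(0,r-q)}\varphi\leftrightarrow(\nabla_q\varphi\to\nabla_r\varphi),$$ $$\nabla_r\nabla_q\varphi\leftrightarrow\nabla_{rq}\varphi,\qquad \nabla_1\varphi\leftrightarrow\varphi;$$ the only rule is modus ponens, and $\vdash\varphi$ means that $\varphi$ is derivable. A $[0,1]$-evaluation is a map $e$ from formulas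 to $[0,1]$ with $e(\neg\varphi)=1-e(\varphi)$, $e(\varphi\to\psi)=\min(1,1-e(\varphi)+e(\psi))$ and $e(\nabla_r\varphi)=1-r(1-e(\varphi))$. Fix any theorem $\eta$ of $\mathcal{R}$Ł and put $\eta_r:=\neg\nabla_r\neg\eta$ for $r\in[0,1]$. Proposition (Pavelka completeness). For every formula $\varphi$ of $\mathcal{R}$Ł, the set $\{r\in[0,1] : \ \vdash\eta_r\to\varphi\}$ has a maximum (the provability degree of $\varphi$), the set $\{e(\varphi) : e \text{ a } [0,1]\text{-evaluation}\}$ has a minimum (the truth degree of $\varphi$), and $$\max\{r\in[0,1] : \ \vdash\eta_r\to\varphi\}=\min\{e(\varphi) : e\text{ a }[0,1]\text{-evaluation}\}.$$ -/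

import Mathlib

/-! The propositional logic of Riesz MV-algebras: syntax, Hilbert calculus,
evaluations in the standard Riesz MV-algebra `[0,1]`, truth and provability degrees. -/

namespace RieszLogic

open scoped unitInterval

/-- The Łukasiewicz strong conjunction `x ⊙ y = max 0 (x + y - 1)` on `[0,1]`. -/
noncomputable def odot (x y : I) : I :=
  ⟨max 0 ((x : ℝ) + y - 1), le_max_left _ _,
    max_le zero_le_one (by linarith [x.2.2, y.2.2])⟩

/-- The Łukasiewicz implication `min 1 (1 - x + y)` on `[0,1]`. -/
noncomputable def limp (x y : I) : I :=
  ⟨min 1 (1 - (x : ℝ) + y), le_min zero_le_one (by linarith [x.2.2, y.2.1]),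
    min_le_left _ _⟩

/-- Formulas over a set `V` of propositional variables, with the primitive connectives
negation, implication and one unary connective `nabla r` for every `r ∈ [0,1]`. -/
inductive Formula (V : Type*) : Type _
  | var (v : V) : Formula V
  | neg (φ : Formula V) : Formula V
  | imp (φ ψ : Formula V) : Formula V
  | nabla (r : I) (φ : Formula V) : Formula V

namespace Formula

variable {V : Type*}

/-- Disjunction `φ ∨ ψ := (φ → ψ) → ψ`. -/
def disj (φ ψ : Formula V) : Formula V := imp (imp φ ψ) ψ

/-- Conjunction `φ ∧ ψ := ¬(¬φ ∨ ¬ψ)`. -/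
def conj (φ ψ : Formula V) : Formula V := neg (disj (neg φ) (neg ψ))

/-- Equivalence `φ ↔ ψ := (φ → ψ) ∧ (ψ → φ)`. -/
def iff (φ ψ : Formula V) : Formula V := conj (imp φ ψ) (imp ψ φ)

/-- The derived connective `Δ_r φ := ¬ ∇_r ¬ φ`. -/
def delta (r : I) (φ : Formula V) : Formula V := neg (nabla r (neg φ))

end Formula

open Formula

/-- The theorems of the logic: the axioms of Łukasiewicz logic and of the connectives
`∇_r`, closed under modus ponens. -/
inductive Provable {V : Type*} : Formula V → Prop
  | luk1 (φ ψ : Formula V) : Provable (imp φ (imp ψ φ))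
  | luk2 (φ ψ χ : Formula V) :
      Provable (imp (imp φ ψ) (imp (imp ψ χ) (imp φ χ)))
  | luk3 (φ ψ : Formula V) :
      Provable (imp (imp (imp φ ψ) ψ) (imp (imp ψ φ) φ))
  | luk4 (φ ψ : Formula V) :
      Provable (imp (imp (neg ψ) (neg φ)) (imp φ ψ))
  | nabla_imp (r : I) (φ ψ : Formula V) :
      Provable (iff (nabla r (imp φ ψ)) (imp (nabla r φ) (nabla r ψ)))
  | nabla_odot (r q : I) (φ : Formula V) :
      Provable (iff (nabla (odot r (σ q)) φ) (imp (nabla q φ) (nabla r φ)))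
  | nabla_nabla (r q : I) (φ : Formula V) :
      Provable (iff (nabla r (nabla q φ)) (nabla (r * q) φ))
  | nabla_one (φ : Formula V) : Provable (iff (nabla 1 φ) φ)
  | mp {φ ψ : Formula V} (h₁ : Provable φ) (h₂ : Provable (imp φ ψ)) : Provable ψ

/-- A `[0,1]`-evaluation: a map from formulas to the standard Riesz MV-algebra `[0,1]`
commuting with all connectives. Here `σ x = 1 - x`, and `∇_r` is interpreted by the dual
`x ↦ (r x*)*` of the scalar multiplication, so that `Δ_r` is interpreted by `x ↦ r x`. -/
structure Evaluation (V : Type*) where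
  val : Formula V → I
  val_neg : ∀ φ, val (neg φ) = σ (val φ)
  val_imp : ∀ φ ψ, val (imp φ ψ) = limp (val φ) (val ψ)
  val_nabla : ∀ r φ, val (nabla r φ) = σ (r * σ (val φ))

/-- The set of values `e(φ)`, for `e` a `[0,1]`-evaluation. -/
def truthValues {V : Type*} (φ : Formula V) : Set I :=
  {t | ∃ e : Evaluation V, e.val φ = t}

/-- The set of those `r ∈ [0,1]` with `⊢ η_r → φ`, where `η_r = Δ_r η`. -/
def provabilityValues {V : Type*} (η φ : Formula V) : Set I :=
  {r | Provable (imp (delta r η) φ)}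

/-- The truth degree, as an infimum in `[0,1]`. -/
noncomputable def truthDegree {V : Type*} (φ : Formula V) : I := sInf (truthValues φ)

/-- The provability degree (with respect to a fixed theorem `η`), as a supremum in `[0,1]`. -/
noncomputable def provabilityDegree {V : Type*} (η φ : Formula V) : I :=
  sSup (provabilityValues η φ)

end RieszLogic

/-! Everything reduces to standard completeness: a formula with value 1 under every evaluation is a
theorem (`provable_of_forall_eval`). Since e(η_r) = r, the formula η_r → φ has value 1 under e
exactly when r ≤ e(φ). With soundness, the set of admissible r is therefore the closed interval from
0 to the truth degree (`provabilityValues_eq_Iic`). The truth degree is attained because e(φ)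
depends continuously on the values of the variables, a point of a compact cube.

For completeness, extend the theorems to a theory maximal without an unprovable φ. Its Lindenbaum
algebra is a totally ordered Riesz MV-algebra in which the class of φ is below 1. Evaluating φ
involves finitely many elements, so a map to ℝ that respects the strict order, the scalars and the
untruncated sums inside a finite set is enough (`exists_local_embedding`). Such a map comes from
Hahn–Banach: scaled by a small ε, formal positive combinations of the elements add without
truncation, so the strictly positive differences form a convex set disjoint from the subspace of
relations. A functional that kills the relations and is positive on the finitely many required
differences is the map; normalised at 1, it yields an evaluation with e(φ) < 1. -/

namespace RieszLogic
open scoped unitInterval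

/-! ### Riesz MV-algebras: order, joins and truncated addition. -/

/-- Riesz MV-algebras, presented by implication, complement and the operators `∇_r`. -/
class RieszMV (A : Type*) extends HImp A, Compl A, One A where
  nab : I → A → A
  mp : ∀ x : A, (1 : A) ⇨ x = 1 → x = 1
  himp_antisymm : ∀ x y : A, x ⇨ y = 1 → y ⇨ x = 1 → x = y
  weakening : ∀ x y : A, x ⇨ (y ⇨ x) = 1
  suffixing : ∀ x y z : A, (x ⇨ y) ⇨ ((y ⇨ z) ⇨ (x ⇨ z)) = 1
  sup_comm' : ∀ x y : A, ((x ⇨ y) ⇨ y) ⇨ ((y ⇨ x) ⇨ x) = 1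
  contra : ∀ x y : A, (yᶜ ⇨ xᶜ) ⇨ (x ⇨ y) = 1
  nab_himp : ∀ (r : I) (x y : A), nab r (x ⇨ y) = nab r x ⇨ nab r y
  nab_odot : ∀ (r q : I) (x : A), nab (odot r (σ q)) x = nab q x ⇨ nab r x
  nab_nab : ∀ (r q : I) (x : A), nab r (nab q x) = nab (r * q) x
  nab_one : ∀ x : A, nab 1 x = x

namespace RieszMV

variable {A : Type*} [RieszMV A]

theorem trans' {x y z : A} (h : x ⇨ y = 1) (k : y ⇨ z = 1) : x ⇨ z = 1 := by
  have := suffixing x y z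
  rw [h] at this
  have := mp _ this
  rw [k] at this
  exact mp _ this

theorem assertion (x y : A) : x ⇨ ((x ⇨ y) ⇨ y) = 1 :=
  trans' (weakening x (y ⇨ x)) (sup_comm' y x)

theorem one_himp (x : A) : (1 : A) ⇨ x = x :=
  himp_antisymm _ _ (mp _ (assertion 1 x)) (weakening x 1)

theorem himp_self' (x : A) : x ⇨ x = 1 := by
  have := assertion 1 x
  rw [one_himp, one_himp] at this
  exact this

instance : PartialOrder A where
  le x y := x ⇨ y = 1
  le_refl := himp_self'
  le_trans _ _ _ := trans'
  le_antisymm := himp_antisymm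

theorem le_def {x y : A} : x ≤ y ↔ x ⇨ y = 1 := Iff.rfl

theorem le_one (x : A) : x ≤ 1 := by
  have := weakening (1 : A) x
  rw [one_himp] at this
  exact this

theorem eq_one_of_one_le {x : A} (h : 1 ≤ x) : x = 1 := le_antisymm (le_one x) h

theorem himp_anti {x y : A} (h : x ≤ y) (z : A) : y ⇨ z ≤ x ⇨ z := by
  have := suffixing x y z
  rw [le_def.1 h, one_himp] at this
  exact this

theorem exchange_le (x y z : A) : x ⇨ (y ⇨ z) ≤ y ⇨ (x ⇨ z) :=
  le_trans (suffixing x (y ⇨ z) z) (himp_anti (assertion y z) _)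

theorem exchange (x y z : A) : x ⇨ (y ⇨ z) = y ⇨ (x ⇨ z) :=
  le_antisymm (exchange_le x y z) (exchange_le y x z)

theorem himp_mono (x : A) {y z : A} (h : y ≤ z) : x ⇨ y ≤ x ⇨ z := by
  have := suffixing x y z
  rw [exchange, le_def.1 h, one_himp] at this
  exact this

instance : Zero A := ⟨(1 : A)ᶜ⟩

theorem compl_one : (1 : A)ᶜ = 0 := rfl

theorem compl_le_himp (x y : A) : xᶜ ≤ x ⇨ y :=
  le_trans (weakening xᶜ yᶜ) (contra x y)

theorem zero_le' (x : A) : 0 ≤ x := by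
  simpa [one_himp, compl_one] using compl_le_himp (1 : A) x

theorem compl_compl_le (x : A) : xᶜᶜ ≤ x := by
  refine le_trans (compl_le_himp xᶜ (1 : A)ᶜ) ?_
  simpa [one_himp] using le_def.2 (contra (1 : A) x)

theorem compl_compl' (x : A) : xᶜᶜ = x := by
  refine le_antisymm (compl_compl_le x) ?_
  have h := contra x xᶜᶜ
  rw [le_def.1 (compl_compl_le xᶜ), one_himp] at h
  exact h

theorem himp_compl_compl (x y : A) : yᶜ ⇨ xᶜ = x ⇨ y := by
  refine le_antisymm (contra x y) ?_
  simpa [compl_compl'] using le_def.2 (contra yᶜ xᶜ)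

theorem compl_zero : (0 : A)ᶜ = 1 := compl_compl' 1

theorem himp_zero (x : A) : x ⇨ 0 = xᶜ := by
  rw [← himp_compl_compl, compl_zero, one_himp]

theorem compl_le_compl' {x y : A} : yᶜ ≤ xᶜ ↔ x ≤ y := by
  rw [le_def, le_def, himp_compl_compl]

theorem le_compl_comm {x y : A} : x ≤ yᶜ ↔ y ≤ xᶜ := by
  rw [← compl_le_compl', compl_compl']

theorem sup_symm (x y : A) : (x ⇨ y) ⇨ y = (y ⇨ x) ⇨ x :=
  le_antisymm (sup_comm' x y) (sup_comm' y x)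

theorem le_sup_left' (x y : A) : x ≤ (x ⇨ y) ⇨ y := assertion x y

theorem le_sup_right' (x y : A) : y ≤ (x ⇨ y) ⇨ y := weakening _ _

theorem sup_le' {x y z : A} (hx : x ≤ z) (hy : y ≤ z) : (x ⇨ y) ⇨ y ≤ z := by
  refine le_trans (himp_anti (himp_anti hx y) y) ?_
  rw [sup_symm, le_def.1 hy, one_himp]

theorem sup_eq_of_le {x y : A} (h : y ≤ x) : (x ⇨ y) ⇨ y = x :=
  le_antisymm (sup_le' le_rfl h) (le_sup_left' x y)

/-- This is truncated addition (strong disjunction). It cancels only under a side condition such as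
`x ≤ yᶜ`, which says that the sum does not overflow. -/
instance : AddCommMonoid A where
  add x y := xᶜ ⇨ y
  zero_add x := by change (0 : A)ᶜ ⇨ x = x; rw [compl_zero, one_himp]
  add_zero x := by change xᶜ ⇨ 0 = x; rw [himp_zero, compl_compl']
  add_comm x y := by
    change xᶜ ⇨ y = yᶜ ⇨ x
    rw [← himp_compl_compl, compl_compl']
  add_assoc x y z := by
    change (xᶜ ⇨ y)ᶜ ⇨ z = xᶜ ⇨ (yᶜ ⇨ z)
    rw [← himp_compl_compl, compl_compl', exchange, ← himp_compl_compl yᶜ z, compl_compl']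
  nsmul n x := Nat.rec 0 (fun _ y => yᶜ ⇨ x) n
  nsmul_zero _ := rfl
  nsmul_succ _ _ := rfl

theorem add_def (x y : A) : x + y = xᶜ ⇨ y := rfl

theorem himp_eq_add (x y : A) : x ⇨ y = xᶜ + y := by rw [add_def, compl_compl']

theorem add_le_add' {x y z w : A} (h : x ≤ y) (k : z ≤ w) : x + z ≤ y + w :=
  le_trans (himp_mono _ k) (himp_anti (compl_le_compl'.2 h) _)

theorem add_compl (x : A) : x + xᶜ = 1 := by rw [add_def, himp_self']

/-- Truncated difference. -/
def tsub (x y : A) : A := (x ⇨ y)ᶜ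

theorem tsub_eq_zero {x y : A} : tsub x y = 0 ↔ x ≤ y := by
  rw [tsub, ← compl_one, le_def]
  exact ⟨fun h => by rw [← compl_compl' (x ⇨ y), h, compl_compl'], fun h => by rw [h]⟩

theorem tsub_add_cancel {x y : A} (h : y ≤ x) : y + tsub x y = x := by
  rw [add_comm, add_def, tsub, compl_compl', sup_eq_of_le h]

theorem add_tsub_cancel {x y : A} (h : x ≤ yᶜ) : tsub (x + y) y = x := by
  rw [tsub, add_def, sup_eq_of_le (le_compl_comm.1 h), compl_compl']

theorem add_lt_add' {x y z w : A} (h : x < y) (k : z ≤ w) (hd : y ≤ wᶜ) : x + z < y + w := by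
  refine lt_of_le_of_ne (add_le_add' h.le k) fun he => h.ne ?_
  have h1 : x + w = y + w :=
    le_antisymm (add_le_add' h.le le_rfl) (he ▸ add_le_add' le_rfl k)
  rw [← add_tsub_cancel hd, ← h1, add_tsub_cancel (h.le.trans hd)]

/-- Let j be the join of x and y, and w that of the two implications. Antitonicity gives `w ⇨ jᶜ ≤
xᶜ` and `w ⇨ jᶜ ≤ yᶜ`, hence `w ⇨ jᶜ ≤ jᶜ`. As `jᶜ ≤ w`, the join `(w ⇨ jᶜ) ⇨ jᶜ` is w itself, so w
= 1. -/
theorem prelinear (x y : A) : ((x ⇨ y) ⇨ (y ⇨ x)) ⇨ (y ⇨ x) = 1 := by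
  have key : ∀ {j y w : A}, y ≤ j → j ⇨ y ≤ w → w ⇨ jᶜ ≤ yᶜ := fun {j y w} hy h => by
    refine le_trans (himp_anti h _) ?_
    rw [← himp_compl_compl j y, sup_eq_of_le (compl_le_compl'.2 hy)]
  set w := ((x ⇨ y) ⇨ (y ⇨ x)) ⇨ (y ⇨ x) with hw
  set j := (x ⇨ y) ⇨ y with hj
  have hy : j ⇨ y ≤ w := le_trans (himp_anti (le_sup_left' x y) y) (le_sup_left' _ _)
  have hx : j ⇨ x ≤ w := le_trans (himp_anti (le_sup_right' x y) x) (le_sup_right' _ _)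
  have h1 : w ⇨ jᶜ ≤ jᶜ :=
    le_compl_comm.1 (sup_le' (le_compl_comm.1 (key (le_sup_left' x y) hx))
      (le_compl_comm.1 (key (le_sup_right' x y) hy)))
  rw [← sup_eq_of_le (le_trans (compl_le_himp j y) hy)]
  exact h1

/-- Elements whose join with a is 1 are closed under modus ponens; this makes `polar` a theory. -/
theorem sup_mp {a x y : A} (h : (a ⇨ x) ⇨ x = 1) (k : (a ⇨ (x ⇨ y)) ⇨ (x ⇨ y) = 1) :
    (a ⇨ y) ⇨ y = 1 := by
  have h1 : x ≤ (a ⇨ y) ⇨ y := by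
    refine eq_one_of_one_le ?_
    rw [← k]
    refine sup_le' ?_ (himp_mono _ (le_sup_right' a y))
    exact le_trans (le_sup_left' a y) (weakening _ _)
  refine eq_one_of_one_le ?_
  rw [← h]
  exact sup_le' (le_sup_left' a y) h1

/-! ### Scalar multiplication by the unit interval. -/

theorem nab_one_right (r : I) : nab r (1 : A) = 1 := by
  rw [← himp_self' (1 : A), nab_himp, himp_self', himp_self']

instance : SMul I A := ⟨fun r x => (nab r xᶜ)ᶜ⟩

theorem smul_def (r : I) (x : A) : r • x = (nab r xᶜ)ᶜ := rfl

theorem nab_eq (r : I) (x : A) : nab r x = (r • xᶜ)ᶜ := by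
  rw [smul_def, compl_compl', compl_compl']

theorem one_smul' (x : A) : (1 : I) • x = x := by rw [smul_def, nab_one, compl_compl']

theorem mul_smul' (r s : I) (x : A) : r • s • x = (r * s) • x := by
  rw [smul_def, smul_def, compl_compl', nab_nab, smul_def]

theorem smul_zero' (r : I) : r • (0 : A) = 0 := by
  rw [smul_def, compl_zero, nab_one_right, compl_one]

theorem smul_tsub (r : I) (x y : A) : r • tsub x y = tsub (r • x) (r • y) := by
  rw [smul_def, tsub, compl_compl', ← himp_compl_compl, nab_himp, tsub, smul_def, smul_def,
    himp_compl_compl]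

theorem smul_mono (r : I) {x y : A} (h : x ≤ y) : r • x ≤ r • y := by
  rw [← tsub_eq_zero, ← smul_tsub, tsub_eq_zero.2 h, smul_zero']

theorem odot_symm_eq {r s t : I} (h : max 0 ((r : ℝ) - s) = t) : odot r (σ s) = t := by
  ext
  rw [← h]
  simp only [odot, unitInterval.coe_symm_eq]
  congr 1
  ring

theorem nab_zero (x : A) : nab 0 x = 1 := by
  rw [← odot_symm_eq (r := 1) (s := 1) (t := 0) (by simp), nab_odot, himp_self']

theorem zero_smul' (x : A) : (0 : I) • x = 0 := by rw [smul_def, nab_zero, compl_one]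

theorem smul_mono_left {r s : I} (h : r ≤ s) (x : A) : r • x ≤ s • x := by
  rw [smul_def, smul_def, compl_le_compl', le_def, ← nab_odot,
    odot_symm_eq (t := 0) (by simpa using h), nab_zero]

theorem tsub_smul {r s t : I} (h : (t : ℝ) = r + s) (x : A) :
    tsub (t • x) (r • x) = s • x := by
  rw [smul_def, smul_def, smul_def, tsub, himp_compl_compl, ← nab_odot,
    odot_symm_eq (t := s) (by rw [h]; simp [s.2.1])]

theorem add_smul' {r s t : I} (h : (t : ℝ) = r + s) (x : A) : t • x = r • x + s • x := by
  rw [← tsub_smul h, tsub_add_cancel]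
  exact smul_mono_left (by rw [← Subtype.coe_le_coe, h]; linarith [s.2.1]) x

theorem smul_le_compl_smul {r s : I} (h : (r : ℝ) + s ≤ 1) (x : A) : s • x ≤ (r • x)ᶜ := by
  let t : I := ⟨r + s, add_nonneg r.2.1 s.2.1, h⟩
  rw [← tsub_smul (t := t) (r := r) rfl, tsub, compl_le_compl']
  exact weakening _ _

theorem smul_add' (r : I) {x y : A} (h : x ≤ yᶜ) : r • (x + y) = r • x + r • y := by
  have h1 : r • x = tsub (r • (x + y)) (r • y) := by
    rw [← smul_tsub, add_tsub_cancel h]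
  have h2 : r • y ≤ r • (x + y) := by
    refine smul_mono r ?_
    have := add_le_add' (zero_le' x) (le_refl y)
    rwa [zero_add] at this
  rw [h1, add_comm (tsub _ _), tsub_add_cancel h2]

/-- Archimedean argument: the truncated multiples min(1, nr) all annihilate x, since consecutive
ones differ by at most r, and they reach 1. -/
theorem eq_zero_of_smul_eq_zero {r : I} (hr : 0 < r) {x : A} (h : r • x = 0) : x = 0 := by
  have key : ∀ n : ℕ, (Set.projIcc (0 : ℝ) 1 zero_le_one (n * r)) • x = 0 := by
    intro n
    induction n with
    | zero => simp [zero_smul']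
    | succ n ih =>
      set p := Set.projIcc (0 : ℝ) 1 zero_le_one (n * r)
      set q := Set.projIcc (0 : ℝ) 1 zero_le_one ((n + 1 : ℕ) * r)
      have hpq : (p : ℝ) ≤ q := by
        refine Set.monotone_projIcc zero_le_one (?_ : (n : ℝ) * r ≤ (n + 1 : ℕ) * r)
        push_cast
        linarith [r.2.1]
      have hq : (q : ℝ) ≤ p + r := by
        have := r.2.1
        have hn : (0 : ℝ) ≤ n * r := by positivity
        simp only [p, q, Set.coe_projIcc]
        push_cast
        rw [max_le_iff]
        constructor
        · have : (0 : ℝ) ≤ max 0 (min 1 ((n : ℝ) * r)) := le_max_left _ _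
          linarith
        · refine le_trans ?_ (add_le_add_left (le_max_right 0 _) _)
          rcases le_total 1 ((n : ℝ) * r) with h | h
          · rw [min_eq_left h]
            exact (min_le_left _ _).trans (by linarith)
          · rw [min_eq_right h]
            exact (min_le_right _ _).trans (by linarith)
      let d : I := ⟨q - p, by linarith, by linarith [q.2.2, p.2.1]⟩
      have hd : d • x = 0 := by
        refine le_antisymm ?_ (zero_le' _)
        rw [← h]
        exact smul_mono_left (by rw [← Subtype.coe_le_coe]; simp only [d]; linarith) x
      rw [add_smul' (t := q) (r := p) (s := d) (by simp [d]), ih, hd, add_zero]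
  obtain ⟨n, hn⟩ := exists_nat_ge (1 / (r : ℝ))
  have hr' : (0 : ℝ) < r := hr
  have := key n
  rw [Set.projIcc_of_right_le _ ((div_le_iff₀ hr').1 hn)] at this
  rw [← one_smul' x]
  exact this

theorem smul_le_smul_iff {r : I} (hr : 0 < r) {x y : A} : r • x ≤ r • y ↔ x ≤ y := by
  refine ⟨fun h => ?_, smul_mono r⟩
  rw [← tsub_eq_zero] at h ⊢
  rw [← smul_tsub] at h
  exact eq_zero_of_smul_eq_zero hr h

theorem smul_lt_smul {r : I} (hr : 0 < r) {x y : A} (h : x < y) : r • x < r • y := by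
  rw [lt_iff_le_not_ge, smul_le_smul_iff hr, smul_le_smul_iff hr, ← lt_iff_le_not_ge]
  exact h


/-! ### Real-valued maps on finite subsets, by Hahn–Banach. -/

section LocalEmbedding

open Filter Topology

variable {A : Type*} [RieszMV A] {ι : Type*} [Fintype ι] (a : ι → A)

/-- Truncation of a real number to the unit interval. -/
noncomputable def clamp (t : ℝ) : I := Set.projIcc 0 1 zero_le_one t

theorem coe_clamp {t : ℝ} (h0 : 0 ≤ t) (h1 : t ≤ 1) : (clamp t : ℝ) = t := by
  rw [clamp, Set.projIcc_of_mem _ ⟨h0, h1⟩]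

theorem clamp_zero : clamp 0 = 0 := Set.projIcc_left _

theorem clamp_pos {t : ℝ} (h0 : 0 < t) (h1 : t ≤ 1) : 0 < clamp t := by
  rw [← Subtype.coe_lt_coe, coe_clamp h0.le h1]
  exact h0

theorem clamp_mul {t : ℝ} (h0 : 0 ≤ t) (h1 : t ≤ 1) (r : I) : clamp (t * r) = clamp t * r := by
  ext
  rw [coe_clamp (mul_nonneg h0 r.2.1) (mul_le_one₀ h1 r.2.1 r.2.2), Set.Icc.coe_mul,
    coe_clamp h0 h1]

theorem clamp_add_smul {s t : ℝ} (hs : 0 ≤ s) (ht : 0 ≤ t) (h : s + t ≤ 1) (x : A) :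
    clamp (s + t) • x = clamp s • x + clamp t • x := by
  apply add_smul'
  rw [coe_clamp (add_nonneg hs ht) h, coe_clamp hs (by linarith), coe_clamp ht (by linarith)]

/-- The combination `∑ i, (ε * c i) • a i`, with coefficients truncated to `[0,1]`. -/
noncomputable def comb (ε : ℝ) (c : ι → ℝ) : A := ∑ i, clamp (ε * c i) • a i

/-- Rescaling the coefficients is a reparametrisation of ε, which for t > 0 preserves the filter of
small positive ε; hence the eventual relations are stable under positive scaling. -/
theorem comb_smul (ε t : ℝ) (c : ι → ℝ) : comb a ε (t • c) = comb a (ε * t) c := by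
  simp only [comb, Pi.smul_apply, smul_eq_mul, mul_assoc]

theorem comb_single [DecidableEq ι] (ε t : ℝ) (i : ι) :
    comb a ε (Pi.single i t) = clamp (ε * t) • a i := by
  rw [comb, Finset.sum_eq_single i]
  · rw [Pi.single_eq_same]
  · intro j _ hj
    rw [Pi.single_eq_of_ne hj, mul_zero, clamp_zero, zero_smul']
  · simp

theorem eventually_pos : ∀ᶠ ε : ℝ in 𝓝[>] 0, 0 < ε := self_mem_nhdsWithin

theorem eventually_mul_le_one (K : ℝ) : ∀ᶠ ε : ℝ in 𝓝[>] 0, ε * K ≤ 1 := by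
  have : Tendsto (fun ε : ℝ => ε * K) (𝓝[>] 0) (𝓝 (0 * K)) :=
    ((continuous_id.mul continuous_const).tendsto 0).mono_left nhdsWithin_le_nhds
  rw [zero_mul] at this
  exact this.eventually (Iic_mem_nhds one_pos)

theorem tendsto_mul_pos {t : ℝ} (ht : 0 < t) :
    Tendsto (fun ε : ℝ => ε * t) (𝓝[>] 0) (𝓝[>] 0) := by
  refine tendsto_nhdsWithin_iff.2 ⟨?_, ?_⟩
  · have : Tendsto (fun ε : ℝ => ε * t) (𝓝[>] 0) (𝓝 (0 * t)) :=
      ((continuous_id.mul continuous_const).tendsto 0).mono_left nhdsWithin_le_nhds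
    rwa [zero_mul] at this
  · filter_upwards [eventually_pos] with ε hε using mul_pos hε ht

theorem comb_add {c d : ι → ℝ} (hc : 0 ≤ c) (hd : 0 ≤ d) :
    ∀ᶠ ε : ℝ in 𝓝[>] 0, comb a ε (c + d) = comb a ε c + comb a ε d := by
  have h : ∀ᶠ ε : ℝ in 𝓝[>] 0, ∀ i, ε * (c i + d i) ≤ 1 :=
    eventually_all.2 fun i => eventually_mul_le_one _
  filter_upwards [h, eventually_pos] with ε h hε
  rw [comb, comb, comb, ← Finset.sum_add_distrib]
  refine Finset.sum_congr rfl fun i _ => ?_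
  rw [Pi.add_apply, mul_add]
  exact clamp_add_smul (mul_nonneg hε.le (hc i)) (mul_nonneg hε.le (hd i))
    (by rw [← mul_add]; exact h i) _

theorem sum_clamp_smul_le {κ : Type*} (a : κ → A) {t : κ → ℝ} (ht : 0 ≤ t) (s : Finset κ)
    (h : ∑ i ∈ s, t i ≤ 1) :
    ∑ i ∈ s, clamp (t i) • a i ≤ clamp (∑ i ∈ s, t i) • (1 : A) := by
  classical
  induction s using Finset.induction_on with
  | empty => rw [Finset.sum_empty]; exact zero_le' _
  | insert i s hi ih =>
    rw [Finset.sum_insert hi] at h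
    rw [Finset.sum_insert hi, Finset.sum_insert hi,
      clamp_add_smul (ht i) (Finset.sum_nonneg fun j _ => ht j) h]
    exact add_le_add' (smul_mono _ (le_one _)) (ih (by linarith [show (0 : ℝ) ≤ t i from ht i]))

/-- For small ε both combinations are bounded by multiples of 1 whose coefficients sum to at most 1,
so their sum does not overflow. This supplies the side condition of `add_lt_add'`. -/
theorem comb_le_compl {c d : ι → ℝ} (hc : 0 ≤ c) (hd : 0 ≤ d) :
    ∀ᶠ ε : ℝ in 𝓝[>] 0, comb a ε c ≤ (comb a ε d)ᶜ := by
  filter_upwards [eventually_mul_le_one (∑ i, c i + ∑ i, d i), eventually_pos] with ε h hε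
  have hc' : 0 ≤ ∑ i, ε * c i := Finset.sum_nonneg fun i _ => mul_nonneg hε.le (hc i)
  have hd' : 0 ≤ ∑ i, ε * d i := Finset.sum_nonneg fun i _ => mul_nonneg hε.le (hd i)
  rw [mul_add, Finset.mul_sum, Finset.mul_sum] at h
  refine le_trans (sum_clamp_smul_le a (fun i => mul_nonneg hε.le (hc i)) _ (by linarith)) ?_
  refine le_trans ?_ (compl_le_compl'.2
    (sum_clamp_smul_le a (fun i => mul_nonneg hε.le (hd i)) _ (by linarith)))
  refine smul_le_compl_smul ?_ _
  rw [coe_clamp hc' (by linarith), coe_clamp hd' (by linarith)]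
  linarith

/-- The vectors of coefficients that represent a positive infinitesimal multiple. -/
def IsPos (w : ι → ℝ) : Prop :=
  ∃ c d : ι → ℝ, 0 ≤ c ∧ 0 ≤ d ∧ w = c - d ∧ ∀ᶠ ε : ℝ in 𝓝[>] 0, comb a ε d < comb a ε c

theorem comb_add_lt {c d c' d' : ι → ℝ} (hc : 0 ≤ c) (hd : 0 ≤ d) (hc' : 0 ≤ c') (hd' : 0 ≤ d')
    (h : ∀ᶠ ε : ℝ in 𝓝[>] 0, comb a ε d < comb a ε c)
    (h' : ∀ᶠ ε : ℝ in 𝓝[>] 0, comb a ε d' ≤ comb a ε c') :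
    ∀ᶠ ε : ℝ in 𝓝[>] 0, comb a ε (d + d') < comb a ε (c + c') := by
  filter_upwards [h, h', comb_add a hc hc', comb_add a hd hd', comb_le_compl a hc hc'] with
    ε h1 h2 h3 h4 h5
  rw [h3, h4]
  exact add_lt_add' h1 h2 h5

/-- The linear relations between the elements `a i`. -/
def relations : Submodule ℝ (ι → ℝ) where
  carrier := {w | ∃ c d : ι → ℝ, 0 ≤ c ∧ 0 ≤ d ∧ w = c - d ∧
    ∀ᶠ ε : ℝ in 𝓝[>] 0, comb a ε d = comb a ε c}
  zero_mem' := ⟨0, 0, le_rfl, le_rfl, by simp, by simp⟩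
  add_mem' := by
    rintro _ _ ⟨c, d, hc, hd, rfl, h⟩ ⟨c', d', hc', hd', rfl, h'⟩
    refine ⟨c + c', d + d', add_nonneg hc hc', add_nonneg hd hd', by abel, ?_⟩
    filter_upwards [h, h', comb_add a hc hc', comb_add a hd hd'] with ε h1 h2 h3 h4
    rw [h3, h4, h1, h2]
  smul_mem' := by
    rintro t _ ⟨c, d, hc, hd, rfl, h⟩
    rcases lt_trichotomy t 0 with ht | rfl | ht
    · refine ⟨(-t) • d, (-t) • c, smul_nonneg (by linarith) hd, smul_nonneg (by linarith) hc,
        by module, ?_⟩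
      filter_upwards [(tendsto_mul_pos (neg_pos.2 ht)).eventually h] with ε h1
      rw [comb_smul, comb_smul, h1]
    · exact ⟨0, 0, le_rfl, le_rfl, by simp, by simp⟩
    · refine ⟨t • c, t • d, smul_nonneg ht.le hc, smul_nonneg ht.le hd, by module, ?_⟩
      filter_upwards [(tendsto_mul_pos ht).eventually h] with ε h1
      rw [comb_smul, comb_smul, h1]

theorem convex_isPos : Convex ℝ {w | IsPos a w} := by
  rw [convex_iff_forall_pos]
  rintro _ ⟨c, d, hc, hd, rfl, h⟩ _ ⟨c', d', hc', hd', rfl, h'⟩ s t hs ht -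
  refine ⟨s • c + t • c', s • d + t • d',
    add_nonneg (smul_nonneg hs.le hc) (smul_nonneg ht.le hc'),
    add_nonneg (smul_nonneg hs.le hd) (smul_nonneg ht.le hd'), by module, ?_⟩
  refine comb_add_lt a (smul_nonneg hs.le hc) (smul_nonneg hs.le hd) (smul_nonneg ht.le hc')
    (smul_nonneg ht.le hd') ?_ ?_
  · filter_upwards [(tendsto_mul_pos hs).eventually h] with ε h1
    rwa [comb_smul, comb_smul]
  · filter_upwards [(tendsto_mul_pos ht).eventually h'] with ε h1
    rw [comb_smul, comb_smul]
    exact h1.le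

/-- Adding a representation of w as positive to one of -w as a relation gives the same coefficients
on both sides of a strict inequality. -/
theorem not_isPos_of_mem_relations {w : ι → ℝ} (h : w ∈ relations a) : ¬ IsPos a w := by
  rintro ⟨c, d, hc, hd, hw, h1⟩
  obtain ⟨c', d', hc', hd', hw', h2⟩ := (relations a).neg_mem h
  have h3 := comb_add_lt a hc hd hc' hd' h1 (h2.mono fun _ => le_of_eq)
  have h4 : c + c' = d + d' := by
    rw [hw] at hw'
    rw [← sub_eq_zero]
    calc c + c' - (d + d') = (c - d) + (c' - d') := by abel
      _ = 0 := by rw [← hw']; abel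
  rw [h4] at h3
  obtain ⟨ε, hε⟩ := h3.exists
  exact lt_irrefl _ hε

theorem exists_linear (S : Set (ι → ℝ)) (hS : S.Finite) (hpos : ∀ w ∈ S, IsPos a w) :
    ∃ f : (ι → ℝ) →ₗ[ℝ] ℝ, (∀ w ∈ relations a, f w = 0) ∧ ∀ w ∈ S, 0 < f w := by
  have hdisj : Disjoint (convexHull ℝ S) (relations a : Set (ι → ℝ)) :=
    Set.disjoint_left.2 fun w hw hw' =>
      not_isPos_of_mem_relations a hw' (convexHull_min hpos (convex_isPos a) hw)
  obtain ⟨f, u, v, h1, h2, h3⟩ := geometric_hahn_banach_compact_closed (convex_convexHull ℝ S)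
    (hS.isCompact_convexHull (𝕜 := ℝ)) (relations a).convex (relations a).closed_of_finiteDimensional hdisj
  have h0 : ∀ w ∈ relations a, f w = 0 := by
    intro w hw
    by_contra hne
    -- A functional bounded below by v on a subspace vanishes there: otherwise this multiple of w
    -- takes the value v - 1.
    have := h3 _ ((relations a).smul_mem ((v - 1) / f w) hw)
    rw [map_smul, smul_eq_mul, div_mul_cancel₀ _ hne] at this
    linarith
  refine ⟨-f.toLinearMap, fun w hw => by simp [h0 w hw], fun w hw => ?_⟩
  have hv := h3 0 (relations a).zero_mem
  rw [map_zero] at hv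
  have := h1 w (subset_convexHull ℝ S hw)
  simp only [LinearMap.neg_apply, ContinuousLinearMap.coe_coe]
  linarith

/-- Every finite part of a Riesz MV-algebra embeds, strictly monotonically, in the reals. -/
theorem exists_local_embedding (s : Finset A) :
    ∃ g : A → ℝ, (0 ∈ s → g 0 = 0) ∧ (∀ x ∈ s, ∀ y ∈ s, x < y → g x < g y) ∧
      (∀ (r : I), ∀ x ∈ s, r • x ∈ s → g (r • x) = r * g x) ∧
      (∀ x ∈ s, ∀ y ∈ s, x + y ∈ s → x ≤ yᶜ → g (x + y) = g x + g y) := by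
  classical
  let a : s → A := Subtype.val
  let e : s → (s → ℝ) := fun i => Pi.single i 1
  have he : ∀ i, 0 ≤ e i := fun i => Pi.single_nonneg.2 zero_le_one
  have hcomb : ∀ ε i, comb a ε (e i) = clamp ε • (i : A) := fun ε i => by
    rw [comb_single, mul_one]
  obtain ⟨f, hf0, hf⟩ := exists_linear a
    ((fun p : s × s => e p.2 - e p.1) '' {p | (p.1 : A) < p.2}) (Set.toFinite _) (by
      rintro _ ⟨⟨i, j⟩, hij, rfl⟩
      refine ⟨e j, e i, he j, he i, rfl, ?_⟩
      filter_upwards [eventually_pos, eventually_mul_le_one 1] with ε h0 h1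
      rw [mul_one] at h1
      rw [hcomb, hcomb]
      exact smul_lt_smul (clamp_pos h0 h1) hij)
  let g : A → ℝ := fun x => if h : x ∈ s then f (e ⟨x, h⟩) else 0
  have hg : ∀ x (h : x ∈ s), g x = f (e ⟨x, h⟩) := fun x h => dif_pos h
  refine ⟨g, fun h => ?_, fun x hx y hy hxy => ?_, fun r x hx hrx => ?_,
    fun x hx y hy hxy hd => ?_⟩
  · rw [hg _ h]
    refine hf0 _ ⟨e ⟨0, h⟩, 0, he _, le_rfl, by simp, ?_⟩
    filter_upwards with ε
    rw [hcomb, smul_zero', ← zero_smul ℝ (0 : s → ℝ), comb_smul, comb]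
    simp [clamp_zero, zero_smul']
  · rw [hg _ hx, hg _ hy, ← sub_pos, ← map_sub]
    exact hf _ ⟨(⟨x, hx⟩, ⟨y, hy⟩), hxy, rfl⟩
  · rw [hg _ hx, hg _ hrx, ← sub_eq_zero, ← smul_eq_mul, ← map_smul, ← map_sub]
    refine hf0 _ ⟨_, _, he _, smul_nonneg r.2.1 (he _), rfl, ?_⟩
    filter_upwards [eventually_pos, eventually_mul_le_one 1] with ε h0 h1
    rw [mul_one] at h1
    rw [hcomb, comb_smul, hcomb, mul_smul', clamp_mul h0.le h1]
  · rw [hg _ hx, hg _ hy, hg _ hxy, ← sub_eq_zero, ← map_add, ← map_sub]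
    refine hf0 _ ⟨_, _, he _, add_nonneg (he _) (he _), rfl, ?_⟩
    filter_upwards [comb_add a (he ⟨x, hx⟩) (he ⟨y, hy⟩)] with ε h
    rw [h, hcomb, hcomb, hcomb, smul_add' _ hd]

end LocalEmbedding

end RieszMV

/-! ### Theories and their Lindenbaum algebras. -/

open Formula

variable {V : Type*}

/-- A nonempty set of formulas containing all theorems and closed under modus ponens. -/
structure Theory (V : Type*) where
  carrier : Set (Formula V)
  nonempty : carrier.Nonempty
  provable_mem : ∀ {φ}, Provable φ → φ ∈ carrier
  mp_mem : ∀ {φ ψ}, φ ∈ carrier → imp φ ψ ∈ carrier → ψ ∈ carrier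

namespace Theory

variable (T : Theory V) {φ ψ χ : Formula V}

theorem imp_trans (h : imp φ ψ ∈ T.carrier) (k : imp ψ χ ∈ T.carrier) : imp φ χ ∈ T.carrier :=
  T.mp_mem k (T.mp_mem h (T.provable_mem (.luk2 φ ψ χ)))

theorem imp_of_mem (h : ψ ∈ T.carrier) : imp φ ψ ∈ T.carrier :=
  T.mp_mem h (T.provable_mem (.luk1 _ _))

theorem imp_assertion : imp φ (imp (imp φ ψ) ψ) ∈ T.carrier :=
  T.imp_trans (T.provable_mem (.luk1 φ (imp ψ φ))) (T.provable_mem (.luk3 ψ φ))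

theorem imp_imp_self_of_mem (h : φ ∈ T.carrier) : imp (imp φ ψ) ψ ∈ T.carrier :=
  T.mp_mem h T.imp_assertion

theorem imp_self : imp φ φ ∈ T.carrier := by
  obtain ⟨τ, hτ⟩ := T.nonempty
  exact T.imp_trans (T.provable_mem (.luk1 φ τ)) (T.imp_imp_self_of_mem hτ)

theorem imp_anti (h : imp φ ψ ∈ T.carrier) : imp (imp ψ χ) (imp φ χ) ∈ T.carrier :=
  T.mp_mem h (T.provable_mem (.luk2 φ ψ χ))

theorem imp_exchange : imp (imp φ (imp ψ χ)) (imp ψ (imp φ χ)) ∈ T.carrier :=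
  T.imp_trans (T.provable_mem (.luk2 _ _ _)) (T.imp_anti T.imp_assertion)

theorem imp_mono (h : imp ψ χ ∈ T.carrier) : imp (imp φ ψ) (imp φ χ) ∈ T.carrier :=
  T.mp_mem h (T.mp_mem (T.provable_mem (.luk2 φ ψ χ)) T.imp_exchange)

theorem neg_neg_imp : imp (neg (neg φ)) φ ∈ T.carrier := by
  obtain ⟨τ, hτ⟩ := T.nonempty
  have h : imp (neg (neg φ)) (imp (neg φ) (neg τ)) ∈ T.carrier :=
    T.imp_trans (T.provable_mem (.luk1 _ (neg (neg τ)))) (T.provable_mem (.luk4 _ _))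
  exact T.imp_trans h (T.imp_trans (T.provable_mem (.luk4 _ _)) (T.imp_imp_self_of_mem hτ))

theorem imp_neg_neg : imp φ (neg (neg φ)) ∈ T.carrier :=
  T.mp_mem T.neg_neg_imp (T.provable_mem (.luk4 _ _))

theorem neg_anti (h : imp φ ψ ∈ T.carrier) : imp (neg ψ) (neg φ) ∈ T.carrier :=
  T.mp_mem (T.imp_trans T.neg_neg_imp (T.imp_trans h T.imp_neg_neg)) (T.provable_mem (.luk4 _ _))

theorem conj_left (h : conj φ ψ ∈ T.carrier) : φ ∈ T.carrier :=
  T.mp_mem h (T.imp_trans (T.neg_anti T.imp_assertion) T.neg_neg_imp)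

theorem conj_right (h : conj φ ψ ∈ T.carrier) : ψ ∈ T.carrier :=
  T.mp_mem h (T.imp_trans (T.neg_anti (T.provable_mem (.luk1 _ _))) T.neg_neg_imp)

theorem nabla_zero_mem : nabla 0 φ ∈ T.carrier := by
  have h := T.provable_mem (.nabla_odot 1 1 φ)
  rw [RieszMV.odot_symm_eq (t := 0) (by simp)] at h
  exact T.mp_mem T.imp_self (T.conj_right h)

/-- Necessitation is derived: `nabla_odot` with q = 1 has index max(0, r - 1) = 0, so the theorem
∇_0 φ yields ∇_1 φ → ∇_r φ. -/
theorem nabla_mem (r : I) (h : φ ∈ T.carrier) : nabla r φ ∈ T.carrier := by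
  have h1 := T.provable_mem (.nabla_odot r 1 φ)
  rw [RieszMV.odot_symm_eq (t := 0) (by simp [r.2.2])] at h1
  exact T.mp_mem (T.mp_mem h (T.conj_right (T.provable_mem (.nabla_one φ))))
    (T.mp_mem T.nabla_zero_mem (T.conj_left h1))

theorem nabla_mono (r : I) (h : imp φ ψ ∈ T.carrier) :
    imp (nabla r φ) (nabla r ψ) ∈ T.carrier :=
  T.mp_mem (T.nabla_mem r h) (T.conj_left (T.provable_mem (.nabla_imp r φ ψ)))

/-- Equivalence of formulas modulo a theory. -/
def setoid : Setoid (Formula V) where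
  r φ ψ := imp φ ψ ∈ T.carrier ∧ imp ψ φ ∈ T.carrier
  iseqv :=
    { refl := fun _ => ⟨T.imp_self, T.imp_self⟩
      symm := fun h => ⟨h.2, h.1⟩
      trans := fun h k => ⟨T.imp_trans h.1 k.1, T.imp_trans k.2 h.2⟩ }

/-- The Lindenbaum algebra of a theory. -/
def Lindenbaum : Type _ := Quotient T.setoid

/-- The class of a formula in the Lindenbaum algebra. -/
def quot (φ : Formula V) : T.Lindenbaum := Quotient.mk T.setoid φ

theorem quot_eq_quot : T.quot φ = T.quot ψ ↔ imp φ ψ ∈ T.carrier ∧ imp ψ φ ∈ T.carrier :=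
  Quotient.eq (r := T.setoid)

theorem quot_eq_of_iff (h : Provable (iff φ ψ)) : T.quot φ = T.quot ψ :=
  T.quot_eq_quot.2 ⟨T.conj_left (T.provable_mem h), T.conj_right (T.provable_mem h)⟩

noncomputable instance : One T.Lindenbaum := ⟨T.quot T.nonempty.some⟩

instance : Compl T.Lindenbaum :=
  ⟨Quotient.map' neg fun _ _ h => ⟨T.neg_anti h.2, T.neg_anti h.1⟩⟩

instance : HImp T.Lindenbaum :=
  ⟨Quotient.map₂ imp fun _ _ h _ _ k =>
    ⟨T.imp_trans (T.imp_anti h.2) (T.imp_mono k.1),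
      T.imp_trans (T.imp_anti h.1) (T.imp_mono k.2)⟩⟩

/-- The operators `∇_r` on the Lindenbaum algebra. -/
def nab (r : I) : T.Lindenbaum → T.Lindenbaum :=
  Quotient.map' (nabla r) fun _ _ h => ⟨T.nabla_mono r h.1, T.nabla_mono r h.2⟩

theorem quot_neg : T.quot (neg φ) = (T.quot φ)ᶜ := rfl

theorem quot_imp : T.quot (imp φ ψ) = T.quot φ ⇨ T.quot ψ := rfl

theorem quot_eq_one : T.quot φ = 1 ↔ φ ∈ T.carrier :=
  T.quot_eq_quot.trans ⟨fun h => T.mp_mem T.nonempty.some_mem h.2,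
    fun h => ⟨T.imp_of_mem T.nonempty.some_mem, T.imp_of_mem h⟩⟩

theorem quot_surjective : Function.Surjective T.quot := Quotient.mk_surjective

noncomputable instance : RieszMV T.Lindenbaum where
  nab := T.nab
  mp := T.quot_surjective.forall.2 fun _ h =>
    T.quot_eq_one.2 (T.mp_mem T.nonempty.some_mem (T.quot_eq_one.1 h))
  himp_antisymm := T.quot_surjective.forall₂.2 fun _ _ h k =>
    T.quot_eq_quot.2 ⟨T.quot_eq_one.1 h, T.quot_eq_one.1 k⟩
  weakening := T.quot_surjective.forall₂.2 fun _ _ =>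
    T.quot_eq_one.2 (T.provable_mem (.luk1 _ _))
  suffixing := T.quot_surjective.forall₃.2 fun _ _ _ =>
    T.quot_eq_one.2 (T.provable_mem (.luk2 _ _ _))
  sup_comm' := T.quot_surjective.forall₂.2 fun _ _ =>
    T.quot_eq_one.2 (T.provable_mem (.luk3 _ _))
  contra := T.quot_surjective.forall₂.2 fun _ _ =>
    T.quot_eq_one.2 (T.provable_mem (.luk4 _ _))
  nab_himp r := T.quot_surjective.forall₂.2 fun _ _ => T.quot_eq_of_iff (.nabla_imp r _ _)
  nab_odot r q := T.quot_surjective.forall.2 fun _ => T.quot_eq_of_iff (.nabla_odot r q _)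
  nab_nab r q := T.quot_surjective.forall.2 fun _ => T.quot_eq_of_iff (.nabla_nabla r q _)
  nab_one := T.quot_surjective.forall.2 fun _ => T.quot_eq_of_iff (.nabla_one _)

theorem quot_nabla (r : I) : T.quot (nabla r φ) = (r • (T.quot φ)ᶜ)ᶜ :=
  RieszMV.nab_eq r (T.quot φ)

/-! ### Maximal theories and total order. -/

/-- A theory is maximal without `φ` if it omits `φ` and no larger theory does. -/
def IsMaximalWithout (φ : Formula V) : Prop :=
  φ ∉ T.carrier ∧ ∀ T' : Theory V, T.carrier ⊆ T'.carrier → φ ∉ T'.carrier →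
    T'.carrier ⊆ T.carrier

/-- The theory of all formulas `χ` with `x ∨ χ = 1` in the Lindenbaum algebra. -/
def polar (x : T.Lindenbaum) : Theory V where
  carrier := {χ | (x ⇨ T.quot χ) ⇨ T.quot χ = 1}
  nonempty := by
    obtain ⟨τ, hτ⟩ := T.nonempty
    refine ⟨τ, RieszMV.eq_one_of_one_le ?_⟩
    rw [← T.quot_eq_one.2 hτ]
    exact RieszMV.le_sup_right' _ _
  provable_mem h := by
    refine RieszMV.eq_one_of_one_le ?_
    rw [← T.quot_eq_one.2 (T.provable_mem h)]
    exact RieszMV.le_sup_right' _ _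
  mp_mem h k := RieszMV.sup_mp h k

theorem subset_polar (x : T.Lindenbaum) : T.carrier ⊆ (T.polar x).carrier := by
  intro χ hχ
  refine RieszMV.eq_one_of_one_le ?_
  rw [← T.quot_eq_one.2 hχ]
  exact RieszMV.le_sup_right' _ _

variable {T}

/-- If α ∨ β = 1 with neither in T, the polar of α contains β, so by maximality it contains φ. Then
the polar of φ contains α, hence also φ, so φ ∨ φ = 1 and φ is in T. -/
theorem IsMaximalWithout.prime (h : T.IsMaximalWithout φ) {x y : T.Lindenbaum}
    (hxy : (x ⇨ y) ⇨ y = 1) : x = 1 ∨ y = 1 := by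
  by_contra! hne
  obtain ⟨α, rfl⟩ := T.quot_surjective x
  obtain ⟨β, rfl⟩ := T.quot_surjective y
  rw [Ne, T.quot_eq_one, Ne, T.quot_eq_one] at hne
  have h1 : φ ∈ (T.polar (T.quot α)).carrier := by
    by_contra hφ
    exact hne.2 (h.2 _ (T.subset_polar _) hφ hxy)
  have h2 : φ ∈ (T.polar (T.quot φ)).carrier := by
    by_contra hφ
    exact hne.1 (h.2 _ (T.subset_polar _) hφ ((RieszMV.sup_symm _ _).trans h1))
  have h3 : (T.quot φ ⇨ T.quot φ) ⇨ T.quot φ = 1 := h2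
  rw [RieszMV.himp_self', RieszMV.one_himp, T.quot_eq_one] at h3
  exact h.1 h3

theorem IsMaximalWithout.le_total (h : T.IsMaximalWithout φ) (x y : T.Lindenbaum) :
    x ≤ y ∨ y ≤ x :=
  h.prime (RieszMV.prelinear x y)

theorem exists_isMaximalWithout (h : ¬ Provable φ) : ∃ T : Theory V, T.IsMaximalWithout φ := by
  let P : Set (Set (Formula V)) := {S | (∃ T : Theory V, T.carrier = S) ∧ φ ∉ S}
  have h0 : {ψ : Formula V | Provable ψ} ∈ P :=
    ⟨⟨⟨_, ⟨imp φ (imp φ φ), .luk1 _ _⟩, fun h => h, fun h k => .mp h k⟩, rfl⟩, h⟩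
  obtain ⟨S, -, hS⟩ := zorn_subset_nonempty P (fun c hc hchain hne => by
    refine ⟨⋃₀ c, ⟨⟨⟨⋃₀ c, ?_, ?_, ?_⟩, rfl⟩, ?_⟩, fun s hs => Set.subset_sUnion_of_mem hs⟩
    · obtain ⟨S, hS⟩ := hne
      obtain ⟨⟨T, rfl⟩, -⟩ := hc hS
      exact T.nonempty.mono (Set.subset_sUnion_of_mem hS)
    · intro ψ hψ
      obtain ⟨S, hS⟩ := hne
      obtain ⟨⟨T, rfl⟩, -⟩ := hc hS
      exact ⟨_, hS, T.provable_mem hψ⟩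
    · rintro ψ χ ⟨S, hS, h1⟩ ⟨S', hS', h2⟩
      obtain ⟨U, hU, hSU, hSU'⟩ := hchain.directedOn S hS S' hS'
      obtain ⟨⟨T, rfl⟩, -⟩ := hc hU
      exact ⟨_, hU, T.mp_mem (hSU h1) (hSU' h2)⟩
    · rintro ⟨S, hS, h1⟩
      exact (hc hS).2 h1) _ h0
  obtain ⟨⟨T, rfl⟩, hT⟩ := hS.prop
  exact ⟨T, hT, fun T' hle hφ => hS.le_of_ge ⟨⟨T', rfl⟩, hφ⟩ hle⟩

end Theory

/-! ### Evaluations: compactness and soundness. -/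

/-- The value of a formula under an assignment of truth values to the variables. -/
noncomputable def evalFormula (u : V → I) : Formula V → I
  | var v => u v
  | neg φ => σ (evalFormula u φ)
  | imp φ ψ => limp (evalFormula u φ) (evalFormula u ψ)
  | nabla r φ => σ (r * σ (evalFormula u φ))

/-- The evaluation extending an assignment of truth values to the variables. -/
noncomputable def Evaluation.ofVar (u : V → I) : Evaluation V where
  val := evalFormula u
  val_neg _ := rfl
  val_imp _ _ := rfl
  val_nabla _ _ := rfl

theorem Evaluation.val_eq (e : Evaluation V) (φ : Formula V) :
    e.val φ = evalFormula (fun v => e.val (var v)) φ := by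
  induction φ with
  | var v => rfl
  | neg φ ih => rw [e.val_neg, ih, evalFormula]
  | imp φ ψ ih₁ ih₂ => rw [e.val_imp, ih₁, ih₂, evalFormula]
  | nabla r φ ih => rw [e.val_nabla, ih, evalFormula]

theorem truthValues_eq_range (φ : Formula V) :
    truthValues φ = Set.range fun u : V → I => evalFormula u φ := by
  ext t
  constructor
  · rintro ⟨e, rfl⟩
    exact ⟨_, (e.val_eq φ).symm⟩
  · rintro ⟨u, rfl⟩
    exact ⟨.ofVar u, rfl⟩

theorem continuous_limp : Continuous fun p : I × I => limp p.1 p.2 := by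
  unfold limp
  fun_prop

theorem continuous_evalFormula (φ : Formula V) : Continuous fun u : V → I => evalFormula u φ := by
  induction φ with
  | var v => exact continuous_apply v
  | neg φ ih => exact unitInterval.continuous_symm.comp ih
  | imp φ ψ ih₁ ih₂ => exact continuous_limp.comp (ih₁.prodMk ih₂)
  | nabla r φ ih =>
    exact unitInterval.continuous_symm.comp
      (continuous_const.mul (unitInterval.continuous_symm.comp ih))

theorem isLeast_truthDegree (φ : Formula V) : IsLeast (truthValues φ) (truthDegree φ) := by
  have h : IsCompact (truthValues φ) := by
    rw [truthValues_eq_range]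
    exact isCompact_range (continuous_evalFormula φ)
  refine h.isLeast_sInf ?_
  rw [truthValues_eq_range]
  exact Set.range_nonempty _

theorem coe_limp (x y : I) : (limp x y : ℝ) = min 1 (1 - (x : ℝ) + y) := rfl

theorem limp_eq_one {x y : I} : limp x y = 1 ↔ x ≤ y := by
  rw [← Subtype.coe_le_coe, Subtype.ext_iff]
  simp only [limp, Set.Icc.coe_one, min_eq_left_iff]
  constructor <;> intro h <;> linarith

theorem Evaluation.val_iff (e : Evaluation V) {φ ψ : Formula V} (h : e.val φ = e.val ψ) :
    e.val (iff φ ψ) = 1 := by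
  simp only [iff, conj, disj, e.val_neg, e.val_imp, h, limp_eq_one.2 le_rfl]
  simp [limp]

theorem Evaluation.val_eq_one (e : Evaluation V) {φ : Formula V} (h : Provable φ) :
    e.val φ = 1 := by
  induction h with
  | luk1 φ ψ =>
    rw [e.val_imp, e.val_imp, limp_eq_one, ← Subtype.coe_le_coe]
    have h1 := (e.val φ).2.2
    have h2 := (e.val ψ).2.2
    exact le_min h1 (by linarith)
  | luk2 φ ψ χ =>
    simp only [e.val_imp, limp_eq_one, ← Subtype.coe_le_coe]
    simp only [limp]
    have h1 := (e.val φ).2; have h2 := (e.val ψ).2; have h3 := (e.val χ).2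
    simp only [Set.mem_Icc] at h1 h2 h3
    grind
  | luk3 φ ψ =>
    simp only [e.val_imp, limp_eq_one, ← Subtype.coe_le_coe]
    simp only [limp]
    have h1 := (e.val φ).2; have h2 := (e.val ψ).2
    simp only [Set.mem_Icc] at h1 h2
    grind
  | luk4 φ ψ =>
    simp only [e.val_imp, e.val_neg, limp_eq_one, ← Subtype.coe_le_coe]
    simp only [limp, unitInterval.coe_symm_eq]
    grind
  | nabla_imp r φ ψ =>
    refine e.val_iff ?_
    ext
    simp only [e.val_imp, e.val_nabla]
    simp only [limp, unitInterval.coe_symm_eq, Set.Icc.coe_mul]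
    have h0 := r.2.1
    rcases le_total (e.val φ : ℝ) (e.val ψ) with h | h
    · rw [min_eq_left (by linarith), min_eq_left (by nlinarith)]
      ring
    · rw [min_eq_right (by linarith), min_eq_right (by nlinarith)]
      ring
  | nabla_odot r q φ =>
    refine e.val_iff ?_
    ext
    simp only [e.val_imp, e.val_nabla]
    simp only [limp, odot, unitInterval.coe_symm_eq, Set.Icc.coe_mul]
    have h1 : (0 : ℝ) ≤ 1 - e.val φ := by linarith [(e.val φ).2.2]
    rcases le_total (r : ℝ) q with h | h
    · rw [max_eq_left (by linarith), min_eq_left (by nlinarith)]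
      ring
    · rw [max_eq_right (by linarith), min_eq_right (by nlinarith)]
      ring
  | nabla_nabla r q φ =>
    refine e.val_iff ?_
    simp only [e.val_nabla, unitInterval.symm_symm, mul_assoc]
  | nabla_one φ =>
    refine e.val_iff ?_
    simp only [e.val_nabla, unitInterval.symm_symm, one_mul]
  | mp _ _ ih₁ ih₂ =>
    rw [e.val_imp, limp_eq_one, ih₁] at ih₂
    exact le_antisymm unitInterval.le_one' ih₂

/-! ### From the local embedding to an evaluation, and completeness. -/

namespace Theory

variable (T : Theory V)

open Classical in
/-- The elements of the Lindenbaum algebra that occur in the evaluation of a formula. -/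
noncomputable def support : Formula V → Finset T.Lindenbaum
  | var v => {T.quot (var v)}
  | neg φ => insert (T.quot (neg φ)) (support φ)
  -- The complement is included because implication is evaluated through `x ⇨ y = xᶜ + y`, and
  -- additivity is only known for sums with both terms in the finite set.
  | imp φ ψ => {T.quot (imp φ ψ), (T.quot φ)ᶜ} ∪ (support φ ∪ support ψ)
  | nabla r φ => {T.quot (nabla r φ), (T.quot φ)ᶜ, r • (T.quot φ)ᶜ} ∪ support φ

theorem quot_mem_support (φ : Formula V) : T.quot φ ∈ T.support φ := by
  cases φ <;> simp [support]

variable {T}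

theorem exists_eval_eq (hT : ∀ x y : T.Lindenbaum, x ≤ y ∨ y ≤ x) (s : Finset T.Lindenbaum)
    (h0s : 0 ∈ s) (h1s : 1 ∈ s) (h01 : (0 : T.Lindenbaum) ≠ 1) :
    ∃ (u : V → I) (g : T.Lindenbaum → ℝ), g 1 = 1 ∧ (∀ x ∈ s, ∀ y ∈ s, x < y → g x < g y) ∧
      ∀ φ, T.support φ ⊆ s → (evalFormula u φ : ℝ) = g (T.quot φ) := by
  classical
  obtain ⟨g₀, hz, hlt, hsm, hadd⟩ := RieszMV.exists_local_embedding s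
  have hpos : 0 < g₀ 1 := by
    rw [← hz h0s]
    exact hlt _ h0s _ h1s (lt_of_le_of_ne (RieszMV.zero_le' _) h01)
  -- Dividing by the value at 1 sends 1 to 1, so that complements go to 1 - t.
  let g : T.Lindenbaum → ℝ := fun x => g₀ x / g₀ 1
  have g1 : g 1 = 1 := div_self hpos.ne'
  have gz : g 0 = 0 := by simp [g, hz h0s]
  have glt : ∀ x ∈ s, ∀ y ∈ s, x < y → g x < g y := fun x hx y hy h =>
    div_lt_div_of_pos_right (hlt x hx y hy h) hpos
  have gle : ∀ x ∈ s, ∀ y ∈ s, x ≤ y → g x ≤ g y := fun x hx y hy h =>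
    h.eq_or_lt.elim (fun h => by rw [h]) fun h => (glt x hx y hy h).le
  have gsm : ∀ (r : I), ∀ x ∈ s, r • x ∈ s → g (r • x) = r * g x := fun r x hx h => by
    simp only [g, hsm r x hx h, mul_div_assoc]
  have gadd : ∀ x ∈ s, ∀ y ∈ s, x + y ∈ s → x ≤ yᶜ → g (x + y) = g x + g y :=
    fun x hx y hy h hd => by simp only [g, hadd x hx y hy h hd, add_div]
  have gneg : ∀ x ∈ s, xᶜ ∈ s → g xᶜ = 1 - g x := fun x hx h => by
    have h2 := gadd x hx _ h (by rwa [RieszMV.add_compl]) (by rw [RieszMV.compl_compl'])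
    rw [RieszMV.add_compl, g1] at h2
    linarith
  refine ⟨fun v => RieszMV.clamp (g (T.quot (var v))), g, g1, glt, fun φ => ?_⟩
  induction φ with
  | var v =>
    intro h
    have hv := h (T.quot_mem_support _)
    rw [evalFormula, RieszMV.coe_clamp]
    · rw [← gz]
      exact gle _ h0s _ hv (RieszMV.zero_le' _)
    · rw [← g1]
      exact gle _ hv _ h1s (RieszMV.le_one _)
  | neg φ ih =>
    intro h
    have h1 := h (T.quot_mem_support _)
    rw [support, Finset.insert_subset_iff] at h
    rw [T.quot_neg] at h1 ⊢
    rw [evalFormula, unitInterval.coe_symm_eq, ih h.2, gneg _ (h.2 (T.quot_mem_support _)) h1]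
  | imp φ ψ ih₁ ih₂ =>
    intro h
    have h1 := h (T.quot_mem_support _)
    simp only [support, Finset.union_subset_iff, Finset.insert_subset_iff,
      Finset.singleton_subset_iff] at h
    obtain ⟨⟨-, hn⟩, hφ, hψ⟩ := h
    have hφ' := hφ (T.quot_mem_support _)
    have hψ' := hψ (T.quot_mem_support _)
    rw [T.quot_imp] at h1 ⊢
    rw [evalFormula, coe_limp, ih₁ hφ, ih₂ hψ]
    -- The total order is used here: either the implication is 1, or `ψ ≤ φ` and the sum `φᶜ + ψ`
    -- does not overflow; these are the two branches of the minimum in `limp`.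
    rcases hT (T.quot φ) (T.quot ψ) with h | h
    · rw [RieszMV.le_def.1 h, g1]
      exact min_eq_left (by linarith [gle _ hφ' _ hψ' h])
    · rw [RieszMV.himp_eq_add] at h1 ⊢
      rw [gadd _ hn _ hψ' h1 (RieszMV.compl_le_compl'.2 h), gneg _ hφ' hn]
      exact min_eq_right (by linarith [gle _ hψ' _ hφ' h])
  | nabla r φ ih =>
    intro h
    have h1 := h (T.quot_mem_support _)
    simp only [support, Finset.union_subset_iff, Finset.insert_subset_iff,
      Finset.singleton_subset_iff] at h
    obtain ⟨⟨-, hn, hr⟩, hφ⟩ := h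
    rw [T.quot_nabla] at h1 ⊢
    rw [evalFormula, unitInterval.coe_symm_eq, Set.Icc.coe_mul, unitInterval.coe_symm_eq, ih hφ,
      gneg _ hr h1, gsm _ _ hn hr, gneg _ (hφ (T.quot_mem_support _)) hn]

end Theory

/-- Standard completeness. -/
theorem provable_of_forall_eval {φ : Formula V} (h : ∀ e : Evaluation V, e.val φ = 1) :
    Provable φ := by
  classical
  by_contra hφ
  obtain ⟨T, hT⟩ := Theory.exists_isMaximalWithout hφ
  have hne : T.quot φ ≠ 1 := fun h => hT.1 (T.quot_eq_one.1 h)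
  have h01 : (0 : T.Lindenbaum) ≠ 1 := fun h01 =>
    hne (RieszMV.eq_one_of_one_le (h01 ▸ RieszMV.zero_le' _))
  obtain ⟨u, g, g1, glt, hu⟩ := Theory.exists_eval_eq hT.le_total
    (insert 0 (insert 1 (T.support φ))) (by simp) (by simp) h01
  have h1 := hu φ (fun x hx => by simp [hx])
  have h2 : evalFormula u φ = 1 := h (.ofVar u)
  have h3 := glt (T.quot φ) (by simp [T.quot_mem_support]) 1 (by simp)
    (lt_of_le_of_ne (RieszMV.le_one _) hne)
  rw [← h1, g1, h2] at h3
  exact lt_irrefl _ h3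

/-! ### Provability degree and truth degree. -/

theorem Evaluation.val_delta (e : Evaluation V) (r : I) (φ : Formula V) :
    e.val (delta r φ) = r * e.val φ := by
  simp only [delta, e.val_neg, e.val_nabla, unitInterval.symm_symm]

theorem provabilityValues_eq_Iic {η : Formula V} (hη : Provable η) (φ : Formula V) :
    provabilityValues η φ = Set.Iic (truthDegree φ) := by
  have hval : ∀ (e : Evaluation V) (r : I), e.val (imp (delta r η) φ) = 1 ↔ r ≤ e.val φ := by
    intro e r
    rw [e.val_imp, limp_eq_one, e.val_delta, e.val_eq_one hη, mul_one]
  ext r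
  constructor
  · intro h
    obtain ⟨e, he⟩ := (isLeast_truthDegree φ).1
    rw [Set.mem_Iic, ← he, ← hval]
    exact e.val_eq_one h
  · exact fun h => provable_of_forall_eval fun e =>
      (hval e r).2 (le_trans h ((isLeast_truthDegree φ).2 ⟨e, rfl⟩))

end RieszLogic

theorem mainTheorem3 {V : Type*} (η : RieszLogic.Formula V) (hη : RieszLogic.Provable η)
    (φ : RieszLogic.Formula V) :
    IsGreatest (RieszLogic.provabilityValues η φ) (RieszLogic.provabilityDegree η φ) ∧
      IsLeast (RieszLogic.truthValues φ) (RieszLogic.truthDegree φ) ∧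
      RieszLogic.provabilityDegree η φ = RieszLogic.truthDegree φ := by
  have h : RieszLogic.provabilityDegree η φ = RieszLogic.truthDegree φ := by
    rw [RieszLogic.provabilityDegree, RieszLogic.provabilityValues_eq_Iic hη, csSup_Iic]
  refine ⟨?_, RieszLogic.isLeast_truthDegree φ, h⟩
  rw [h, RieszLogic.provabilityValues_eq_Iic hη]
  exact isGreatest_Iic
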